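/- Let $M$ be a finite-dimensional smooth Hausdorff manifold without boundary and let $\mathcal E^1(M)=(TM\times\mathbb R)\oplus(T^*M\times\mathbb R)$, with the symmetric pairing $$\langle (X_1,f_1)\oplus(\xi_1,g_1),(X_2,f_2)\oplus(\xi_2,g_2)\rangle_+=\tfrac12\big(i_{X_2}\xi_1+i_{X_1}\xi_2+g_1f_2+g_2f_1\big).$$ Let $\bar L\subset\mathcal E^1(M)$ be a Dirac–Jacobi structure, i.e. a smooth subbundle which is maximal isotropic for $\langle\cdot,\cdot\rangle_+$ and whose space of smooth sections is closed under the extended Courant bracket $$\begin{aligned}[(X_1,f_1)\oplus(\xi_1,g_1),(X_2,f_2)\oplus(\xi_2,g_2)]=\ &\big([X_1,X_2],\,X_1\cdot f_2-X_2\cdot f_1\big)\\ \oplus\ \big(&\mathcal L_{X_1}\xi_2-\mathcal L_{X_2}\xi_1+\tfrac12 d(i_{X_2}\xi_1-i_{X_1}\xi_2)+f_1\xi_2-f_2\xi_1\\&+\tfrac12(g_2\,df_1-g_1\,df_2-f_1\,dg_2+f_2\,dg_1),\\ & X_1\cdot g_2-X_2\cdot g_1+\tfrac12(i_{X_2}\xi_1-i_{X_1}\xi_2-f_2g_1+f_1g_2)\big).\end{aligned}$$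 A smooth function $h$ on $M$ is called admissible if there are a smooth vector field $X_h$ and a smooth function $\varphi_h$ such that $(X_h,\varphi_h)\oplus(dh,h)$ is a section of $\bar L$. A smooth function $\psi$ on $M$ is called basic if $X\cdot\psi+\psi f=0$ for all $(X,f)\in\bar L\cap(TM\times\mathbb R)$. If $\psi$ is basic and $h$ is admissible, then the function $$\{\psi,h\}:=X_h\cdot\psi+\psi\,\varphi_h$$ does not depend on the choice of the pair $(X_h,\varphi_h)$, and it is again a (smooth) basic function. -/

import Mathlib

open Set Bundle VectorField
open scoped Manifold ContDiff Topology

noncomputable section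

namespace DJ

variable {E : Type*} [NormedAddCommGroup E] [NormedSpace ℝ E]
  {H : Type*} [TopologicalSpace H] (I : ModelWithCorners ℝ E H)
  {M : Type*} [TopologicalSpace M] [ChartedSpace H M]

/-- The cotangent space `T*_x M`. -/
abbrev Cotangent (x : M) : Type _ := TangentSpace I x →L[ℝ] ℝ

/-- The fibre at `x` of `𝓔¹(M) = (TM × ℝ) ⊕ (T*M × ℝ)`.
An element `((X, f), (ξ, g))` stands for `(X, f) ⊕ (ξ, g)`. -/
abbrev E1Fiber (x : M) : Type _ := (TangentSpace I x × ℝ) × (Cotangent I x × ℝ)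

/-- The symmetric pairing `⟨(X₁,f₁)⊕(ξ₁,g₁), (X₂,f₂)⊕(ξ₂,g₂)⟩₊` on a fibre of `𝓔¹(M)`. -/
def pairing {x : M} (a b : E1Fiber I x) : ℝ :=
  (1 / 2 : ℝ) * (a.2.1 b.1.1 + b.2.1 a.1.1 + a.2.2 * b.1.2 + b.2.2 * a.1.2)

/-- A subspace of a fibre is isotropic if the pairing vanishes identically on it. -/
def IsIsotropic {x : M} (W : Submodule ℝ (E1Fiber I x)) : Prop :=
  ∀ a ∈ W, ∀ b ∈ W, pairing I a b = 0

/-- The vector field `X` is smooth on the set `U`. -/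
def SmoothVectorFieldOn [IsManifold I ∞ M] (X : Π x : M, TangentSpace I x) (U : Set M) : Prop :=
  ContMDiffOn I I.tangent ∞ (fun x => (⟨x, X x⟩ : TangentBundle I M)) U

/-- The `1`-form `ξ` is smooth on the set `U`. -/
def SmoothOneFormOn [IsManifold I ∞ M] (ξ : Π x : M, Cotangent I x) (U : Set M) : Prop :=
  ContMDiffOn I (I.prod 𝓘(ℝ, E →L[ℝ] ℝ)) ∞
    (fun x => TotalSpace.mk' (E →L[ℝ] ℝ) (E := fun x : M => TangentSpace I x →L[ℝ] ℝ) x (ξ x)) U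

/-- The section `e = (X, f) ⊕ (ξ, g)` of `𝓔¹(M)` is smooth on the set `U`. -/
structure SmoothSectionOn [IsManifold I ∞ M] (e : Π x : M, E1Fiber I x) (U : Set M) : Prop where
  vec : SmoothVectorFieldOn I (fun x => (e x).1.1) U
  fn : ContMDiffOn I 𝓘(ℝ, ℝ) ∞ (fun x => (e x).1.2) U
  form : SmoothOneFormOn I (fun x => (e x).2.1) U
  cofn : ContMDiffOn I 𝓘(ℝ, ℝ) ∞ (fun x => (e x).2.2) U

/-- The `1`-form `ξ` read in the preferred chart at `x₀`, as a map from the model space `E` to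
its dual: the pullback of `ξ` by the inverse of the chart. -/
def formInChart (ξ : Π x : M, Cotangent I x) (x₀ : M) (y : E) : E →L[ℝ] ℝ :=
  (ξ ((extChartAt I x₀).symm y)).comp
    (mfderivWithin 𝓘(ℝ, E) I (extChartAt I x₀).symm (range I) y)

/-- The vector field `X` read in the preferred chart at `x₀` (as in Mathlib's `mlieBracket`). -/
def fieldInChart (X : Π x : M, TangentSpace I x) (x₀ : M) (y : E) : E :=
  mpullbackWithin 𝓘(ℝ, E) I (extChartAt I x₀).symm X (range I) y

/-- The Lie derivative `𝓛_X ξ` of a `1`-form along a vector field, by its coordinate formula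
`(𝓛_X ξ)_j = ∑ᵢ Xⁱ ∂ᵢ ξ_j + ∑ᵢ ξᵢ ∂_j Xⁱ` in the preferred chart at `x₀`. -/
def lieDerivForm (X : Π x : M, TangentSpace I x) (ξ : Π x : M, Cotangent I x) (x₀ : M) :
    Cotangent I x₀ :=
  ContinuousLinearMap.comp
    (fderivWithin ℝ (formInChart I ξ x₀) (range I) (extChartAt I x₀ x₀)
        (fieldInChart I X x₀ (extChartAt I x₀ x₀)) +
      (formInChart I ξ x₀ (extChartAt I x₀ x₀)).comp
        (fderivWithin ℝ (fieldInChart I X x₀) (range I) (extChartAt I x₀ x₀)))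
    (mfderiv I 𝓘(ℝ, E) (extChartAt I x₀) x₀)

/-- The extended Courant bracket of two sections of `𝓔¹(M)`;
`mvfderiv I f x` is the differential `df` at `x`. -/
def extCourant (e₁ e₂ : Π x : M, E1Fiber I x) (x : M) : E1Fiber I x :=
  let X₁ : Π x : M, TangentSpace I x := fun y => (e₁ y).1.1
  let X₂ : Π x : M, TangentSpace I x := fun y => (e₂ y).1.1
  let f₁ : M → ℝ := fun y => (e₁ y).1.2
  let f₂ : M → ℝ := fun y => (e₂ y).1.2
  let ξ₁ : Π x : M, Cotangent I x := fun y => (e₁ y).2.1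
  let ξ₂ : Π x : M, Cotangent I x := fun y => (e₂ y).2.1
  let g₁ : M → ℝ := fun y => (e₁ y).2.2
  let g₂ : M → ℝ := fun y => (e₂ y).2.2
  ((mlieBracket I X₁ X₂ x,
      mvfderiv I f₂ x (X₁ x) - mvfderiv I f₁ x (X₂ x)),
    (lieDerivForm I X₁ ξ₂ x - lieDerivForm I X₂ ξ₁ x
        + (1 / 2 : ℝ) • mvfderiv I (fun y => ξ₁ y (X₂ y) - ξ₂ y (X₁ y)) x
        + f₁ x • ξ₂ x - f₂ x • ξ₁ x
        + (1 / 2 : ℝ) • (g₂ x • mvfderiv I f₁ x - g₁ x • mvfderiv I f₂ x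
            - f₁ x • mvfderiv I g₂ x + f₂ x • mvfderiv I g₁ x),
      mvfderiv I g₂ x (X₁ x) - mvfderiv I g₁ x (X₂ x)
        + (1 / 2 : ℝ) * (ξ₁ x (X₂ x) - ξ₂ x (X₁ x) - f₂ x * g₁ x + f₁ x * g₂ x)))

variable (M) in
/-- A Dirac–Jacobi structure on `M`: a maximal isotropic smooth subbundle of `𝓔¹(M)` whose space of
smooth sections is closed under the extended Courant bracket. -/
structure DiracJacobi [IsManifold I ∞ M] where
  /-- the fibres of the subbundle -/
  fiber : Π x : M, Submodule ℝ (E1Fiber I x)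
  /-- each fibre is maximal among the isotropic subspaces -/
  maximal : ∀ x, Maximal (fun W : Submodule ℝ (E1Fiber I x) => IsIsotropic I W) (fiber x)
  /-- near every point there is a smooth frame of the subbundle -/
  exists_frame : ∀ x₀ : M, ∃ U : Set M, IsOpen U ∧ x₀ ∈ U ∧
    ∃ (k : ℕ) (e : Fin k → Π x : M, E1Fiber I x),
      (∀ i, SmoothSectionOn I (e i) U) ∧
      ∀ x ∈ U, LinearIndependent ℝ (fun i => e i x) ∧
        Submodule.span ℝ (range fun i => e i x) = fiber x
  /-- integrability -/
  bracket_mem : ∀ e₁ e₂ : Π x : M, E1Fiber I x,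
    SmoothSectionOn I e₁ univ → SmoothSectionOn I e₂ univ →
    (∀ x, e₁ x ∈ fiber x) → (∀ x, e₂ x ∈ fiber x) →
    ∀ x, extCourant I e₁ e₂ x ∈ fiber x

variable {I} [IsManifold I ∞ M]

/-- `(X, φ)` is a smooth vector field with a smooth function such that `(X, φ) ⊕ (dh, h)` is a
section of `L`; thus `X` is a hamiltonian vector field `X_h` of `h`, and `φ` is a `φ_h`. -/
structure DiracJacobi.IsHamiltonianPair (L : DiracJacobi I M) (h : M → ℝ)
    (X : Π x : M, TangentSpace I x) (φ : M → ℝ) : Prop where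
  smooth_vec : SmoothVectorFieldOn I X univ
  smooth_fn : ContMDiff I 𝓘(ℝ, ℝ) ∞ φ
  mem : ∀ x, ((X x, φ x), (mvfderiv I h x, h x)) ∈ L.fiber x

/-- A smooth function `h` is admissible if it has a hamiltonian pair `(X_h, φ_h)`. -/
def DiracJacobi.IsAdmissible (L : DiracJacobi I M) (h : M → ℝ) : Prop :=
  ContMDiff I 𝓘(ℝ, ℝ) ∞ h ∧ ∃ X φ, L.IsHamiltonianPair h X φ

/-- A smooth function `ψ` is basic if `X·ψ + ψ f = 0` for all `(X, f) ∈ L ∩ (TM × ℝ)`. -/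
def DiracJacobi.IsBasic (L : DiracJacobi I M) (ψ : M → ℝ) : Prop :=
  ContMDiff I 𝓘(ℝ, ℝ) ∞ ψ ∧
    ∀ (x : M) (X : TangentSpace I x) (f : ℝ),
      ((X, f), ((0 : Cotangent I x), (0 : ℝ))) ∈ L.fiber x → mvfderiv I ψ x X + ψ x * f = 0

end DJ

end

/-! The obstacle is that `L ∩ (TM × ℝ)` may change rank from point to point, so an element `(v₀,
f₀)` of it need not extend to a smooth section. The argument therefore transports `(v₀, f₀)` by a
flow instead of extending it.

Maximal isotropy identifies `L ∩ (TM × ℝ)` with the common annihilator of the pairs `(ξ i, g i)`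
read off from a local frame of `L` (`DiracJacobi.tangent_mem_iff`). Along an integral curve `c` of
`X = X_h`, solve `v' = DX(v)` and `f' = dφ(v)`. The values `p i = ξ i (v) + g i * f` then have
derivative `(𝓛_X ξ i)(v) + (X·g i) f + g i dφ(v)`. By isotropy, the bracket of `(X, φ) ⊕ (dh, h)`
with a section of `L` having lower part `(ξ, g)` has lower part `(𝓛_X ξ + φ ξ + g dφ, X·g + φ g)`.
Integrability puts this bracket back in `L`, so it expands in the frame with locally bounded
coefficients, whence `‖p'‖ ≤ C ‖p‖` (`bracket_bound`). Grönwall's inequality and `p 0 = 0` give `p =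
0`: the curve `(v, f)` stays in `L ∩ (TM × ℝ)`.

Hence `dψ(v) + ψ f` vanishes along the curve for small `t ≥ 0`. Its derivative at `0`, plus `φ`
times its value there, is exactly the basicness condition for `X·ψ + ψ φ` at `(v₀, f₀)`
(`twisted_derivative_annihilates`). Independence of the pair is pointwise: two Hamiltonian pairs of
`h` differ by an element of `L ∩ (TM × ℝ)`. -/

noncomputable section

namespace DJ

/-! ### Flow argument and coefficient bounds in normed spaces -/

section Calculus

variable {F : Type*} [NormedAddCommGroup F] [NormedSpace ℝ F]

/-- The coordinate expression of the Lie derivative of a `1`-form `ξ` along a vector field `X` of a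
normed space. -/
def coordLieDeriv (X : F → F) (ξ : F → F →L[ℝ] ℝ) (y : F) : F →L[ℝ] ℝ :=
  fderiv ℝ ξ y (X y) + (ξ y).comp (fderiv ℝ X y)

/-- Solutions of the flow of `X`, linearized and twisted by `φ`. -/
theorem exists_linearized_flow [CompleteSpace F] {X : F → F} {φ : F → ℝ} {y₀ : F}
    (hX : ContDiffAt ℝ 2 X y₀) (hφ : ContDiffAt ℝ 2 φ y₀) (v₀ : F) (f₀ : ℝ) :
    ∃ (c v : ℝ → F) (f : ℝ → ℝ), c 0 = y₀ ∧ v 0 = v₀ ∧ f 0 = f₀ ∧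
      ∀ᶠ t in 𝓝 0, HasDerivAt c (X (c t)) t ∧ HasDerivAt v (fderiv ℝ X (c t) (v t)) t ∧
        HasDerivAt f (fderiv ℝ φ (c t) (v t)) t := by
  -- Flow, linearized flow and twist form one autonomous system. It is `C¹` because `X` and `φ` are
  -- `C²`, so Picard–Lindelöf applies.
  let V : F × F × ℝ → F × F × ℝ := fun p => (X p.1, fderiv ℝ X p.1 p.2.1, fderiv ℝ φ p.1 p.2.1)
  have h1 : ContDiffAt ℝ 1 (fun p : F × F × ℝ => p.1) (y₀, v₀, f₀) := contDiffAt_fst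
  have h2 : ContDiffAt ℝ 1 (fun p : F × F × ℝ => p.2.1) (y₀, v₀, f₀) := by fun_prop
  have hX' : ContDiffAt ℝ 1 (fderiv ℝ X) y₀ := hX.fderiv_right (by norm_num)
  have hφ' : ContDiffAt ℝ 1 (fderiv ℝ φ) y₀ := hφ.fderiv_right (by norm_num)
  have hV : ContDiffAt ℝ 1 V (y₀, v₀, f₀) := by
    refine ContDiffAt.prodMk ?_ (ContDiffAt.prodMk ?_ ?_)
    · exact ContDiffAt.comp (y₀, v₀, f₀) (hX.of_le (by norm_num)) h1
    · exact (ContDiffAt.comp (y₀, v₀, f₀) hX' h1).clm_apply h2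
    · exact (ContDiffAt.comp (y₀, v₀, f₀) hφ' h1).clm_apply h2
  obtain ⟨α, hα0, ε, hε, hα⟩ :=
    hV.exists_forall_mem_closedBall_exists_eq_forall_mem_Ioo_hasDerivAt₀ 0
  refine ⟨fun t => (α t).1, fun t => (α t).2.1, fun t => (α t).2.2, by simp [hα0], by simp [hα0],
    by simp [hα0], ?_⟩
  filter_upwards [Ioo_mem_nhds (show (0 : ℝ) - ε < 0 by linarith) (show 0 < 0 + ε by linarith)]
    with t ht
  have h := hα t ht
  exact ⟨(ContinuousLinearMap.fst ℝ F (F × ℝ)).hasFDerivAt.comp_hasDerivAt t h,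
    ((ContinuousLinearMap.fst ℝ F ℝ).comp
      (ContinuousLinearMap.snd ℝ F (F × ℝ))).hasFDerivAt.comp_hasDerivAt t h,
    ((ContinuousLinearMap.snd ℝ F ℝ).comp
      (ContinuousLinearMap.snd ℝ F (F × ℝ))).hasFDerivAt.comp_hasDerivAt t h⟩

/-- The derivative of the value of `(ξ, g)` on `(v, f)` along the flow of `(X, φ)`. -/
theorem hasDerivAt_pairing_flow {X : F → F} {φ g : F → ℝ} {ξ : F → F →L[ℝ] ℝ}
    {c v : ℝ → F} {f : ℝ → ℝ} {t : ℝ}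
    (hξ : DifferentiableAt ℝ ξ (c t)) (hg : DifferentiableAt ℝ g (c t))
    (hc : HasDerivAt c (X (c t)) t) (hv : HasDerivAt v (fderiv ℝ X (c t) (v t)) t)
    (hf : HasDerivAt f (fderiv ℝ φ (c t) (v t)) t) :
    HasDerivAt (fun s => ξ (c s) (v s) + g (c s) * f s)
      (coordLieDeriv X ξ (c t) (v t) + fderiv ℝ g (c t) (X (c t)) * f t
        + g (c t) * fderiv ℝ φ (c t) (v t)) t := by
  have h1 := (hξ.hasFDerivAt.comp_hasDerivAt t hc).clm_apply hv
  have h2 := (hg.hasFDerivAt.comp_hasDerivAt t hc).mul hf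
  refine (h1.add h2).congr_deriv ?_
  simp [coordLieDeriv]
  ring

/-- If the annihilator of the family `(ξ i, g i)` is preserved by the twisted flow of `(X, φ)`, and
`(dψ, ψ)` vanishes on this annihilator, so does `(db, b)` for `b = X·ψ + ψ φ`. -/
theorem twisted_derivative_annihilates [CompleteSpace F] {ι : Type*} [Fintype ι]
    {X : F → F} {φ ψ : F → ℝ} {ξ : ι → F → F →L[ℝ] ℝ} {g : ι → F → ℝ} {y₀ : F}
    (hX : ContDiffAt ℝ 2 X y₀) (hφ : ContDiffAt ℝ 2 φ y₀) (hψ : ContDiffAt ℝ 2 ψ y₀)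
    (hξ : ∀ i, ∀ᶠ y in 𝓝 y₀, DifferentiableAt ℝ (ξ i) y)
    (hg : ∀ i, ∀ᶠ y in 𝓝 y₀, DifferentiableAt ℝ (g i) y)
    {C : ℝ} (hC : ∀ᶠ y in 𝓝 y₀, ∀ j v f,
      |coordLieDeriv X (ξ j) y v + fderiv ℝ (g j) y (X y) * f + g j y * fderiv ℝ φ y v|
        ≤ C * ‖fun i => ξ i y v + g i y * f‖)
    (hann : ∀ᶠ y in 𝓝 y₀, ∀ v f, (∀ i, ξ i y v + g i y * f = 0) → fderiv ℝ ψ y v + ψ y * f = 0)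
    {v₀ : F} {f₀ : ℝ} (h0 : ∀ i, ξ i y₀ v₀ + g i y₀ * f₀ = 0) :
    fderiv ℝ (fun y => fderiv ℝ ψ y (X y) + ψ y * φ y) y₀ v₀
      + (fderiv ℝ ψ y₀ (X y₀) + ψ y₀ * φ y₀) * f₀ = 0 := by
  obtain ⟨c, v, f, hc0, hv0, hf0, hflow⟩ := exists_linearized_flow hX hφ v₀ f₀
  have hc : Filter.Tendsto c (𝓝 0) (𝓝 y₀) := hc0 ▸ hflow.self_of_nhds.1.continuousAt.tendsto
  let p : ℝ → ι → ℝ := fun t i => ξ i (c t) (v t) + g i (c t) * f t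
  let p' : ℝ → ι → ℝ := fun t i => coordLieDeriv X (ξ i) (c t) (v t)
    + fderiv ℝ (g i) (c t) (X (c t)) * f t + g i (c t) * fderiv ℝ φ (c t) (v t)
  have hev : ∀ᶠ t in 𝓝 (0 : ℝ), HasDerivAt p (p' t) t ∧ ‖p' t‖ ≤ |C| * ‖p t‖ ∧
      ((∀ i, p t i = 0) → fderiv ℝ ψ (c t) (v t) + ψ (c t) * f t = 0) := by
    filter_upwards [hflow, hc.eventually (Filter.eventually_all.2 hξ),
      hc.eventually (Filter.eventually_all.2 hg), hc.eventually hC, hc.eventually hann]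
      with t h1 h2 h3 h4 h5
    refine ⟨hasDerivAt_pi.2 fun i => hasDerivAt_pairing_flow (h2 i) (h3 i) h1.1 h1.2.1 h1.2.2,
      (pi_norm_le_iff_of_nonneg (by positivity)).2 fun i => ?_, h5 _ _⟩
    exact (h4 i (v t) (f t)).trans (mul_le_mul_of_nonneg_right (le_abs_self C) (norm_nonneg _))
  obtain ⟨ε, hε, hball⟩ := Metric.eventually_nhds_iff.1 hev
  have hin : ∀ t ∈ Icc (0 : ℝ) (ε / 2), dist t 0 < ε := fun t ht => by
    rw [Real.dist_eq, sub_zero, abs_of_nonneg ht.1]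
    linarith [ht.2]
  have hp : ∀ t ∈ Icc (0 : ℝ) (ε / 2), p t = 0 := by
    -- Grönwall: a solution of `‖p'‖ ≤ |C| ‖p‖` starting at `0` stays `0`.
    refine eq_zero_of_abs_deriv_le_mul_abs_self_of_eq_zero_right (f' := p') (K := |C|)
      (fun t ht => (hball (hin t ht)).1.continuousAt.continuousWithinAt)
      (fun t ht => (hball (hin t (Ico_subset_Icc_self ht))).1.hasDerivWithinAt) ?_
      (fun t ht => (hball (hin t (Ico_subset_Icc_self ht))).2.1)
    funext i
    simpa [p, hc0, hv0, hf0] using h0 i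
  have hψ' : ContDiffAt ℝ 1 (fderiv ℝ ψ) y₀ := hψ.fderiv_right (by norm_num)
  have hψ1 : DifferentiableAt ℝ ψ y₀ := hψ.differentiableAt (by norm_num)
  have hψ2 : DifferentiableAt ℝ (fderiv ℝ ψ) y₀ := hψ'.differentiableAt (by norm_num)
  have hX1 : DifferentiableAt ℝ X y₀ := hX.differentiableAt (by norm_num)
  have hφ1 : DifferentiableAt ℝ φ y₀ := hφ.differentiableAt (by norm_num)
  obtain ⟨d1, d2, d3⟩ := hflow.self_of_nhds
  have hq := hasDerivAt_pairing_flow (ξ := fderiv ℝ ψ) (g := ψ) (hc0 ▸ hψ2) (hc0 ▸ hψ1) d1 d2 d3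
  -- The vanishing is known only for `t ≥ 0`; a one-sided derivative suffices, since it determines
  -- the two-sided one in `hq`.
  have hq0 : HasDerivWithinAt (fun s => fderiv ℝ ψ (c s) (v s) + ψ (c s) * f s) 0 (Ici 0) 0 := by
    refine (hasDerivWithinAt_const (0 : ℝ) (Ici 0) (0 : ℝ)).congr_of_eventuallyEq_of_mem ?_
      self_mem_Ici
    filter_upwards [Icc_mem_nhdsGE (show (0 : ℝ) < ε / 2 by linarith)] with t ht
    exact (hball (hin t ht)).2.2 fun i => congrFun (hp t ht) i
  have hzero := (uniqueDiffWithinAt_Ici (0 : ℝ)).eq_deriv _ hq.hasDerivWithinAt hq0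
  have hq00 : fderiv ℝ ψ y₀ v₀ + ψ y₀ * f₀ = 0 := hann.self_of_nhds v₀ f₀ h0
  rw [hc0, hv0, hf0] at hzero
  have hD : HasFDerivAt (fun y => fderiv ℝ ψ y (X y) + ψ y * φ y) _ y₀ :=
    (hψ2.hasFDerivAt.clm_apply hX1.hasFDerivAt).add (hψ1.hasFDerivAt.mul hφ1.hasFDerivAt)
  have hsymm : fderiv ℝ (fderiv ℝ ψ) y₀ (X y₀) v₀ = fderiv ℝ (fderiv ℝ ψ) y₀ v₀ (X y₀) :=
    (hψ.isSymmSndFDerivAt (by simp)) _ _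
  rw [hD.fderiv]
  simp only [coordLieDeriv, add_apply, ContinuousLinearMap.comp_apply,
    ContinuousLinearMap.flip_apply, smul_apply, smul_eq_mul] at hzero ⊢
  -- The flow derivative lacks the terms `φ dψ(v₀)` and `ψ φ f₀`, which are `φ` times the
  -- annihilation at `y₀`; the second derivatives of `ψ` match by symmetry.
  linear_combination hzero + φ y₀ * hq00 - hsymm

/-- A continuous family of tuples, linearly independent at one point, has locally uniformly
bounded coordinates. -/
theorem exists_coord_bound {V : Type*} [NormedAddCommGroup V] [NormedSpace ℝ V] {T : Type*}
    [TopologicalSpace T] {ι : Type*} [Fintype ι] {e : ι → T → V} {t₀ : T}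
    (he : ∀ i, ContinuousAt (e i) t₀) (hli : LinearIndependent ℝ fun i => e i t₀) :
    ∃ K > 0, ∀ᶠ t in 𝓝 t₀, ∀ a : ι → ℝ, ‖a‖ ≤ K * ‖∑ i, a i • e i t‖ := by
  let A : (ι → ℝ) →L[ℝ] V := ∑ i, (ContinuousLinearMap.proj i).smulRight (e i t₀)
  have hA : ∀ a, A a = ∑ i, a i • e i t₀ := fun a => by simp [A]
  have hinj : Function.Injective A := by
    rw [injective_iff_map_eq_zero]
    intro a ha
    funext i
    exact Fintype.linearIndependent_iff.1 hli a (by rw [← hA, ha]) i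
  obtain ⟨K, hK, hanti⟩ := A.toLinearMap.exists_antilipschitzWith (LinearMap.ker_eq_bot.2 hinj)
  have hK' : (0 : ℝ) < K := hK
  have hlow : ∀ a, ‖a‖ ≤ K * ‖A a‖ := fun a => by
    simpa using hanti.le_mul_dist a 0
  -- With this threshold the perturbation costs at most `‖a‖ / 2` in the lower bound at `t₀`, which
  -- is absorbed on the left and doubles the constant.
  have hsmall : ∀ᶠ t in 𝓝 t₀, ∑ i, ‖e i t - e i t₀‖ < 1 / (2 * K) := by
    have : ContinuousAt (fun t => ∑ i, ‖e i t - e i t₀‖) t₀ :=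
      tendsto_finsetSum _ fun i _ => ((he i).sub continuousAt_const).norm
    refine this.eventually_lt continuousAt_const ?_
    simpa using hK'
  refine ⟨2 * K, by positivity, hsmall.mono fun t ht a => ?_⟩
  have h1 : ‖A a - ∑ i, a i • e i t‖ ≤ ‖a‖ * (1 / (2 * K)) := by
    rw [hA, ← Finset.sum_sub_distrib]
    calc ‖∑ i, (a i • e i t₀ - a i • e i t)‖ ≤ ∑ i, ‖a i • e i t₀ - a i • e i t‖ := norm_sum_le _ _
      _ ≤ ∑ i, ‖a‖ * ‖e i t - e i t₀‖ := Finset.sum_le_sum fun i _ => by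
        rw [← smul_sub, norm_smul, norm_sub_rev]
        exact mul_le_mul_of_nonneg_right (norm_le_pi_norm a i) (norm_nonneg _)
      _ = ‖a‖ * ∑ i, ‖e i t - e i t₀‖ := by rw [Finset.mul_sum]
      _ ≤ _ := mul_le_mul_of_nonneg_left ht.le (norm_nonneg _)
  have h2 : ‖A a‖ ≤ ‖∑ i, a i • e i t‖ + ‖a‖ * (1 / (2 * K)) :=
    (norm_le_norm_add_norm_sub' _ _).trans (add_le_add_right h1 _)
  have h3 := (hlow a).trans (mul_le_mul_of_nonneg_left h2 hK'.le)
  have h4 : (K : ℝ) * (‖a‖ * (1 / (2 * K))) = ‖a‖ / 2 := by field_simp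
  rw [mul_add, h4] at h3
  linarith

end Calculus

/-! ### Smooth forms, differentials and cut-offs -/

section Smoothness

variable {E : Type*} [NormedAddCommGroup E] [NormedSpace ℝ E]
  {H : Type*} [TopologicalSpace H] {I : ModelWithCorners ℝ E H}
  {M : Type*} [TopologicalSpace M] [ChartedSpace H M] [IsManifold I ∞ M]

theorem contMDiffWithinAt_form_apply {ξ : Π x : M, Cotangent I x} {X : Π x : M, TangentSpace I x}
    {U : Set M} {x : M}
    (hξ : ContMDiffWithinAt I (I.prod 𝓘(ℝ, E →L[ℝ] ℝ)) ∞ (fun x => TotalSpace.mk' (E →L[ℝ] ℝ)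
      (E := fun x : M => TangentSpace I x →L[ℝ] ℝ) x (ξ x)) U x)
    (hX : ContMDiffWithinAt I I.tangent ∞ (fun x => (⟨x, X x⟩ : TangentBundle I M)) U x) :
    ContMDiffWithinAt I 𝓘(ℝ, ℝ) ∞ (fun x => ξ x (X x)) U x :=
  (contMDiffWithinAt_totalSpace.1
    (ContMDiffWithinAt.clm_bundle_apply (E₂ := Bundle.Trivial M ℝ) (F₂ := ℝ) hξ hX)).2

theorem smoothOneFormOn_mvfderiv {h : M → ℝ} (hh : ContMDiff I 𝓘(ℝ, ℝ) ∞ h) :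
    SmoothOneFormOn I (mvfderiv I h) univ := by
  refine contMDiffOn_univ.2 fun x => ?_
  refine (contMDiffAt_hom_bundle (E₂ := Bundle.Trivial M ℝ) (F₂ := ℝ) _).2 ⟨contMDiffAt_id, ?_⟩
  refine ((hh x).mfderiv_const (m := ∞) (by simp)).congr_of_eventuallyEq ?_
  refine Filter.Eventually.of_forall fun y => ?_
  ext v
  simp [ContinuousLinearMap.inCoordinates, inTangentCoordinates, mvfderiv]
  rfl

/-- Cutting a smooth section off by a smooth function supported in its domain. -/
theorem SmoothSectionOn.smul_of_tsupport {e : Π x : M, E1Fiber I x} {U : Set M} {χ : M → ℝ}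
    (he : SmoothSectionOn I e U) (hU : IsOpen U) (hχ : ContMDiff I 𝓘(ℝ, ℝ) ∞ χ)
    (hsupp : tsupport χ ⊆ U) : SmoothSectionOn I (fun x => χ x • e x) univ := by
  -- Nothing is known about `e` outside `U`, so there the product must vanish on a whole
  -- neighbourhood, not only at the point.
  have hloc : ∀ x, x ∉ U → ∀ᶠ y in 𝓝 x, χ y = 0 := fun x hx =>
    notMem_tsupport_iff_eventuallyEq.1 fun h => hx (hsupp h)
  constructor
  · refine contMDiffOn_univ.2 fun x => ?_
    by_cases hx : x ∈ U
    · exact (ContMDiffOn.smul_section hχ.contMDiffOn he.vec).contMDiffAt (hU.mem_nhds hx)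
    · refine (Bundle.contMDiff_zeroSection ℝ (TangentSpace I) x).congr_of_eventuallyEq ?_
      filter_upwards [hloc x hx] with y hy
      simp [hy, zeroSection]
  · refine contMDiffOn_univ.2 fun x => ?_
    by_cases hx : x ∈ U
    · exact (ContMDiffOn.smul hχ.contMDiffOn he.fn).contMDiffAt (hU.mem_nhds hx)
    · refine (contMDiffAt_const (c := (0 : ℝ))).congr_of_eventuallyEq ?_
      filter_upwards [hloc x hx] with y hy
      simp [hy]
  · refine contMDiffOn_univ.2 fun x => ?_
    by_cases hx : x ∈ U
    · exact (ContMDiffOn.smul_section hχ.contMDiffOn he.form).contMDiffAt (hU.mem_nhds hx)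
    · refine (Bundle.contMDiff_zeroSection ℝ
        (fun x : M => TangentSpace I x →L[ℝ] Bundle.Trivial M ℝ x) x).congr_of_eventuallyEq ?_
      filter_upwards [hloc x hx] with y hy
      simp [hy, zeroSection]
  · refine contMDiffOn_univ.2 fun x => ?_
    by_cases hx : x ∈ U
    · exact (ContMDiffOn.smul hχ.contMDiffOn he.cofn).contMDiffAt (hU.mem_nhds hx)
    · refine (contMDiffAt_const (c := (0 : ℝ))).congr_of_eventuallyEq ?_
      filter_upwards [hloc x hx] with y hy
      simp [hy]

end Smoothness

/-! ### Fields, forms and Lie derivatives in a fixed chart -/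

section Chart

variable {E : Type*} [NormedAddCommGroup E] [NormedSpace ℝ E]
  {H : Type*} [TopologicalSpace H] {I : ModelWithCorners ℝ E H}
  {M : Type*} [TopologicalSpace M] [ChartedSpace H M]

variable (I) in
/-- The coordinate frame at `y` of the chart at `x₀`: the derivative of the inverse chart. -/
def chartFrame (x₀ : M) (y : E) : E →L[ℝ] TangentSpace I ((extChartAt I x₀).symm y) :=
  mfderivWithin 𝓘(ℝ, E) I (extChartAt I x₀).symm (range I) y

theorem formInChart_apply (ξ : Π x : M, Cotangent I x) (x₀ : M) (y v : E) :
    formInChart I ξ x₀ y v = ξ ((extChartAt I x₀).symm y) (chartFrame I x₀ y v) :=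
  rfl

variable [IsManifold I ∞ M]

theorem chartFrame_isInvertible {x₀ : M} {y : E} (hy : y ∈ (extChartAt I x₀).target) :
    (chartFrame I x₀ y).IsInvertible :=
  have : IsManifold I 1 M := .of_le (n := ∞) (by simp)
  isInvertible_mfderivWithin_extChartAt_symm hy

theorem chartFrame_fieldInChart (X : Π x : M, TangentSpace I x) {x₀ : M} {y : E}
    (hy : y ∈ (extChartAt I x₀).target) :
    chartFrame I x₀ y (fieldInChart I X x₀ y) = X ((extChartAt I x₀).symm y) :=
  (chartFrame_isInvertible hy).self_apply_inverse _

theorem formInChart_apply_fieldInChart (ξ : Π x : M, Cotangent I x) (X : Π x : M, TangentSpace I x)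
    {x₀ : M} {y : E} (hy : y ∈ (extChartAt I x₀).target) :
    formInChart I ξ x₀ y (fieldInChart I X x₀ y)
      = ξ ((extChartAt I x₀).symm y) (X ((extChartAt I x₀).symm y)) := by
  rw [formInChart_apply, chartFrame_fieldInChart X hy]

theorem fieldInChart_of_eq_chartFrame {X : Π x : M, TangentSpace I x} {x₀ : M} {y v : E}
    (hy : y ∈ (extChartAt I x₀).target)
    (h : X ((extChartAt I x₀).symm y) = chartFrame I x₀ y v) : fieldInChart I X x₀ y = v := by
  have h1 := chartFrame_fieldInChart X hy
  rw [h] at h1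
  exact (chartFrame_isInvertible hy).injective h1

/-- The vector field on the domain of the chart at `x₀` with constant coordinates `v`. -/
def constField (I : ModelWithCorners ℝ E H) (x₀ : M) (v : E) (x : M) : TangentSpace I x :=
  mpullback I 𝓘(ℝ, E) (extChartAt I x₀) (fun _ => v) x

theorem constField_extChartAt_symm {x₀ : M} {y : E} (hy : y ∈ (extChartAt I x₀).target) (v : E) :
    constField I x₀ v ((extChartAt I x₀).symm y) = chartFrame I x₀ y v := by
  have : IsManifold I 1 M := .of_le (n := ∞) (by simp)
  have h1 : (mfderiv I 𝓘(ℝ, E) (extChartAt I x₀) ((extChartAt I x₀).symm y)) ∘L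
      chartFrame I x₀ y = ContinuousLinearMap.id ℝ E :=
    mfderiv_extChartAt_comp_mfderivWithin_extChartAt_symm hy
  have h2 := isInvertible_mfderiv_extChartAt (I := I) ((extChartAt I x₀).map_target hy)
  have h3 : mfderiv I 𝓘(ℝ, E) (extChartAt I x₀) ((extChartAt I x₀).symm y) (chartFrame I x₀ y v)
      = v := DFunLike.congr_fun h1 v
  calc constField I x₀ v ((extChartAt I x₀).symm y)
      = (mfderiv I 𝓘(ℝ, E) (extChartAt I x₀) ((extChartAt I x₀).symm y)).inverse v := rfl
    _ = _ := by
      conv_lhs => rw [← h3]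
      exact h2.inverse_apply_self _

theorem contMDiffAt_constField [CompleteSpace E] {x₀ x : M} (hx : x ∈ (extChartAt I x₀).source) (v : E) :
    ContMDiffAt I I.tangent ∞ (fun x => (⟨x, constField I x₀ v x⟩ : TangentBundle I M)) x := by
  have : IsManifold I 1 M := .of_le (n := ∞) (by simp)
  have hv : ContMDiffAt 𝓘(ℝ, E) 𝓘(ℝ, E).tangent ∞
      (fun y : E => (⟨y, v⟩ : TangentBundle 𝓘(ℝ, E) E)) (extChartAt I x₀ x) :=
    contMDiffAt_vectorSpace_iff_contDiffAt.2 contDiffAt_const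
  exact hv.mpullback_vectorField_preimage
    (contMDiffAt_extChartAt' (n := ∞) (by rwa [extChartAt_source] at hx))
    (isInvertible_mfderiv_extChartAt hx) (by simp)

variable [I.Boundaryless]

theorem contMDiffAt_extChartAt_symm {x₀ : M} {y : E} (hy : y ∈ (extChartAt I x₀).target) :
    ContMDiffAt 𝓘(ℝ, E) I ∞ (extChartAt I x₀).symm y :=
  (contMDiffOn_extChartAt_symm x₀).contMDiffAt ((isOpen_extChartAt_target x₀).mem_nhds hy)

theorem fderiv_comp_extChartAt_symm {f : M → ℝ} {x₀ : M} {y : E}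
    (hy : y ∈ (extChartAt I x₀).target)
    (hf : MDifferentiableAt I 𝓘(ℝ, ℝ) f ((extChartAt I x₀).symm y)) :
    fderiv ℝ (f ∘ (extChartAt I x₀).symm) y = formInChart I (mvfderiv I f) x₀ y := by
  have h := mvfderiv_comp (I' := 𝓘(ℝ, E)) (I := I) (f := (extChartAt I x₀).symm) (g := f) y hf
    ((contMDiffAt_extChartAt_symm hy).mdifferentiableAt (by simp))
  have h2 : mvfderiv 𝓘(ℝ, E) (f ∘ (extChartAt I x₀).symm) y
      = fderiv ℝ (f ∘ (extChartAt I x₀).symm) y := by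
    ext v
    simp [mvfderiv]
    rfl
  rw [← h2, h, formInChart, I.range_eq_univ, mfderivWithin_univ]
  rfl

theorem contDiffAt_comp_extChartAt_symm {f : M → ℝ} {x₀ : M} {y : E}
    (hy : y ∈ (extChartAt I x₀).target)
    (hf : ContMDiffAt I 𝓘(ℝ, ℝ) ∞ f ((extChartAt I x₀).symm y)) :
    ContDiffAt ℝ ∞ (f ∘ (extChartAt I x₀).symm) y :=
  (hf.comp y (contMDiffAt_extChartAt_symm hy)).contDiffAt

theorem formInChart_mvfderiv_eventuallyEq {h : M → ℝ} (hh : ContMDiff I 𝓘(ℝ, ℝ) ∞ h) {x₀ : M}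
    {y : E} (hy : y ∈ (extChartAt I x₀).target) :
    formInChart I (mvfderiv I h) x₀ =ᶠ[𝓝 y] fderiv ℝ (h ∘ (extChartAt I x₀).symm) := by
  filter_upwards [(isOpen_extChartAt_target x₀).mem_nhds hy] with z hz
  exact (fderiv_comp_extChartAt_symm hz ((hh _).mdifferentiableAt (by simp))).symm

variable [FiniteDimensional ℝ E]

theorem contDiffAt_fieldInChart {X : Π x : M, TangentSpace I x} {x₀ : M} {y : E}
    (hy : y ∈ (extChartAt I x₀).target)
    (hX : ContMDiffAt I I.tangent ∞ (fun x => (⟨x, X x⟩ : TangentBundle I M))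
      ((extChartAt I x₀).symm y)) :
    ContDiffAt ℝ ∞ (fieldInChart I X x₀) y := by
  have : IsManifold I 1 M := .of_le (n := ∞) (by simp)
  have : CompleteSpace E := FiniteDimensional.complete ℝ E
  have hinv := chartFrame_isInvertible (I := I) hy
  rw [chartFrame, I.range_eq_univ, mfderivWithin_univ] at hinv
  have := hX.mpullback_vectorField_preimage (contMDiffAt_extChartAt_symm hy) hinv (by simp)
  unfold fieldInChart
  rw [I.range_eq_univ, mpullbackWithin_univ]
  exact contMDiffAt_vectorSpace_iff_contDiffAt.1 this

/-- In finite dimension a covector-valued map is smooth once its values on each constant vector `v`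
are; these are values of `ξ` on the smooth field `constField I x₀ v`. -/
theorem contDiffAt_formInChart {ξ : Π x : M, Cotangent I x} {U : Set M} (hU : IsOpen U)
    (hξ : SmoothOneFormOn I ξ U) {x₀ : M} {y : E} (hy : y ∈ (extChartAt I x₀).target)
    (hyU : (extChartAt I x₀).symm y ∈ U) :
    ContDiffAt ℝ ∞ (formInChart I ξ x₀) y := by
  have : CompleteSpace E := FiniteDimensional.complete ℝ E
  have hopen : IsOpen ((extChartAt I x₀).target ∩ (extChartAt I x₀).symm ⁻¹' U) :=
    (continuousOn_extChartAt_symm x₀).isOpen_inter_preimage (isOpen_extChartAt_target x₀) hU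
  refine ContDiffOn.contDiffAt ?_ (hopen.mem_nhds ⟨hy, hyU⟩)
  refine contDiffOn_clm_apply.2 fun v z hz => ContDiffAt.contDiffWithinAt ?_
  have hO : IsOpen (U ∩ (extChartAt I x₀).source) := hU.inter (isOpen_extChartAt_source x₀)
  have h1 : ContMDiffOn I 𝓘(ℝ, ℝ) ∞ (fun x => ξ x (constField I x₀ v x))
      (U ∩ (extChartAt I x₀).source) :=
    fun x hx => contMDiffWithinAt_form_apply
      ((hξ x hx.1).mono inter_subset_left) (contMDiffAt_constField hx.2 v).contMDiffWithinAt
  have h2 := contDiffAt_comp_extChartAt_symm hz.1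
    (h1.contMDiffAt (hO.mem_nhds ⟨hz.2, (extChartAt I x₀).map_target hz.1⟩))
  refine h2.congr_of_eventuallyEq ?_
  filter_upwards [(isOpen_extChartAt_target x₀).mem_nhds hz.1] with w hw
  rw [formInChart_apply, Function.comp_apply, constField_extChartAt_symm hw]

theorem fieldInChart_mlieBracket {X Z : Π x : M, TangentSpace I x} {x₀ : M} {y : E}
    (hy : y ∈ (extChartAt I x₀).target)
    (hX : ContMDiffAt I I.tangent ∞ (fun x => (⟨x, X x⟩ : TangentBundle I M))
      ((extChartAt I x₀).symm y))
    (hZ : ContMDiffAt I I.tangent ∞ (fun x => (⟨x, Z x⟩ : TangentBundle I M))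
      ((extChartAt I x₀).symm y)) :
    fieldInChart I (mlieBracket I X Z) x₀ y
      = lieBracket ℝ (fieldInChart I X x₀) (fieldInChart I Z x₀) y := by
  have : CompleteSpace E := FiniteDimensional.complete ℝ E
  have htwo : minSmoothness ℝ 2 ≤ ∞ := by
    rw [minSmoothness_of_isRCLikeNormedField]
    exact ENat.LEInfty.out
  have : IsManifold I (minSmoothness ℝ 2) M := .of_le (n := ∞) htwo
  have h := mpullback_mlieBracket (I := 𝓘(ℝ, E)) (hX.mdifferentiableAt (by simp))
    (hZ.mdifferentiableAt (by simp)) (contMDiffAt_extChartAt_symm hy) htwo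
  have key : ∀ V W : Π z : E, TangentSpace 𝓘(ℝ, E) z,
      mlieBracket 𝓘(ℝ, E) V W y = lieBracket ℝ V W y := fun V W => by
    rw [← mlieBracketWithin_univ, mlieBracketWithin_eq_lieBracketWithin]
    exact congrFun lieBracketWithin_univ y
  unfold fieldInChart
  rw [I.range_eq_univ]
  simp only [mpullbackWithin_univ]
  exact h.trans (key _ _)

/-- Cartan's formula for the Lie derivative of a `1`-form, read in any chart. -/
theorem coordLieDeriv_inChart {X Z : Π x : M, TangentSpace I x} {ξ : Π x : M, Cotangent I x}
    {U : Set M} (hU : IsOpen U) (hξ : SmoothOneFormOn I ξ U) {x₀ : M} {y : E}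
    (hy : y ∈ (extChartAt I x₀).target) (hyU : (extChartAt I x₀).symm y ∈ U)
    (hX : ContMDiffAt I I.tangent ∞ (fun x => (⟨x, X x⟩ : TangentBundle I M))
      ((extChartAt I x₀).symm y))
    (hZ : ContMDiffAt I I.tangent ∞ (fun x => (⟨x, Z x⟩ : TangentBundle I M))
      ((extChartAt I x₀).symm y)) :
    coordLieDeriv (fieldInChart I X x₀) (formInChart I ξ x₀) y (fieldInChart I Z x₀ y)
      = mvfderiv I (fun x => ξ x (Z x)) ((extChartAt I x₀).symm y) (X ((extChartAt I x₀).symm y))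
        - ξ ((extChartAt I x₀).symm y) (mlieBracket I X Z ((extChartAt I x₀).symm y)) := by
  have hξ' := (contDiffAt_formInChart hU hξ hy hyU).differentiableAt (by simp)
  have hZ' := (contDiffAt_fieldInChart hy hZ).differentiableAt (by simp)
  have hev : (fun x => ξ x (Z x)) ∘ (extChartAt I x₀).symm
      =ᶠ[𝓝 y] fun z => formInChart I ξ x₀ z (fieldInChart I Z x₀ z) := by
    filter_upwards [(isOpen_extChartAt_target x₀).mem_nhds hy] with w hw
    rw [formInChart_apply_fieldInChart ξ Z hw, Function.comp_apply]
  have hsm : MDifferentiableAt I 𝓘(ℝ, ℝ) (fun x => ξ x (Z x)) ((extChartAt I x₀).symm y) :=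
    ((contMDiffWithinAt_form_apply (hξ _ hyU) hZ.contMDiffWithinAt).contMDiffAt
      (hU.mem_nhds hyU)).mdifferentiableAt
      (by simp)
  have h1 := fderiv_comp_extChartAt_symm hy hsm
  -- In coordinates `X·(ξ(Z)) = (Dξ(X))(Z) + ξ(DZ(X))`; subtracting `ξ(DZ(X) - DX(Z))` leaves the
  -- coordinate Lie derivative.
  rw [hev.fderiv_eq, fderiv_clm_apply hξ' hZ'] at h1
  have h2 := DFunLike.congr_fun h1 (fieldInChart I X x₀ y)
  rw [formInChart_apply_fieldInChart _ _ hy] at h2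
  have h3 := formInChart_apply_fieldInChart ξ (mlieBracket I X Z) hy
  rw [fieldInChart_mlieBracket hy hX hZ, lieBracket_eq, map_sub] at h3
  rw [← h2, ← h3]
  simp [coordLieDeriv]

/-- Cartan's formula for the Lie derivative of a `1`-form. -/
theorem lieDerivForm_apply {X Z : Π x : M, TangentSpace I x} {ξ : Π x : M, Cotangent I x}
    {U : Set M} (hU : IsOpen U) (hξ : SmoothOneFormOn I ξ U) {x : M} (hxU : x ∈ U)
    (hX : ContMDiffAt I I.tangent ∞ (fun x => (⟨x, X x⟩ : TangentBundle I M)) x)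
    (hZ : ContMDiffAt I I.tangent ∞ (fun x => (⟨x, Z x⟩ : TangentBundle I M)) x) :
    lieDerivForm I X ξ x (Z x)
      = mvfderiv I (fun x => ξ x (Z x)) x (X x) - ξ x (mlieBracket I X Z x) := by
  have : IsManifold I 1 M := .of_le (n := ∞) (by simp)
  have heq : (extChartAt I x).symm (extChartAt I x x) = x := extChartAt_to_inv x
  have h := coordLieDeriv_inChart (x₀ := x) (X := X) (Z := Z) hU hξ (mem_extChartAt_target x)
    (by rwa [heq]) (by rwa [heq]) (by rwa [heq])
  rw [heq] at h
  rw [← h]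
  have hZx : fieldInChart I Z x (extChartAt I x x)
      = mfderiv I 𝓘(ℝ, E) (extChartAt I x) x (Z x) := by
    refine fieldInChart_of_eq_chartFrame (mem_extChartAt_target x) ?_
    have h1 := mfderivWithin_extChartAt_symm_comp_mfderiv_extChartAt (I := I)
      (mem_extChartAt_target x)
    have h2 := DFunLike.congr_fun h1 (Z ((extChartAt I x).symm (extChartAt I x x)))
    have h3 : mfderiv I 𝓘(ℝ, E) (extChartAt I x) ((extChartAt I x).symm (extChartAt I x x))
        (Z ((extChartAt I x).symm (extChartAt I x x)))
        = mfderiv I 𝓘(ℝ, E) (extChartAt I x) x (Z x) := by rw [heq]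
    exact h2.symm.trans (congrArg (chartFrame I x (extChartAt I x x)) h3)
  rw [hZx]
  unfold lieDerivForm
  rw [I.range_eq_univ]
  simp only [fderivWithin_univ]
  rfl

/-- The Lie derivative of a `1`-form has the same coordinate expression in all charts. -/
theorem lieDerivForm_chartFrame {X : Π x : M, TangentSpace I x} {ξ : Π x : M, Cotangent I x}
    {U : Set M} (hU : IsOpen U) (hξ : SmoothOneFormOn I ξ U) {x₀ : M} {y : E}
    (hy : y ∈ (extChartAt I x₀).target) (hyU : (extChartAt I x₀).symm y ∈ U)
    (hX : ContMDiffAt I I.tangent ∞ (fun x => (⟨x, X x⟩ : TangentBundle I M))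
      ((extChartAt I x₀).symm y)) (v : E) :
    lieDerivForm I X ξ ((extChartAt I x₀).symm y) (chartFrame I x₀ y v)
      = coordLieDeriv (fieldInChart I X x₀) (formInChart I ξ x₀) y v := by
  have : CompleteSpace E := FiniteDimensional.complete ℝ E
  have hZ := contMDiffAt_constField (I := I) ((extChartAt I x₀).map_target hy) v
  -- Extending `v` to a field with constant coordinates makes Cartan's formula available; its right
  -- side mentions no chart, so it links the preferred chart of the point to the one at `x₀`.
  rw [← constField_extChartAt_symm hy v, lieDerivForm_apply hU hξ hyU hX hZ,
    ← coordLieDeriv_inChart hU hξ hy hyU hX hZ,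
    fieldInChart_of_eq_chartFrame hy (constField_extChartAt_symm hy v)]

/-- `𝓛_Y dh = d(Y·h)`. -/
theorem lieDerivForm_mvfderiv {Y : Π x : M, TangentSpace I x} {h : M → ℝ}
    (hh : ContMDiff I 𝓘(ℝ, ℝ) ∞ h) (hY : SmoothVectorFieldOn I Y univ) (x : M) :
    lieDerivForm I Y (mvfderiv I h) x = mvfderiv I (fun z => mvfderiv I h z (Y z)) x := by
  have hω := smoothOneFormOn_mvfderiv hh
  have hYat : ∀ z, ContMDiffAt I I.tangent ∞ (fun x => (⟨x, Y x⟩ : TangentBundle I M)) z :=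
    contMDiffOn_univ.1 hY
  -- Working at the point `(extChartAt I x₀).symm y` avoids transport between tangent spaces over
  -- equal but not definitionally equal points.
  suffices key : ∀ (x₀ : M) (y : E), y ∈ (extChartAt I x₀).target →
      lieDerivForm I Y (mvfderiv I h) ((extChartAt I x₀).symm y)
        = mvfderiv I (fun z => mvfderiv I h z (Y z)) ((extChartAt I x₀).symm y) by
    have h1 := key x (extChartAt I x x) (mem_extChartAt_target x)
    rwa [extChartAt_to_inv x] at h1
  intro x₀ y hy
  ext w
  obtain ⟨v, rfl⟩ := (chartFrame_isInvertible (I := I) hy).surjective w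
  have hsm : MDifferentiableAt I 𝓘(ℝ, ℝ) (fun z => mvfderiv I h z (Y z))
      ((extChartAt I x₀).symm y) :=
    (contMDiffOn_univ.1 (fun z hz => contMDiffWithinAt_form_apply (hω z hz) (hY z hz))
      _).mdifferentiableAt (by simp)
  have hc : ContDiffAt ℝ 2 (h ∘ (extChartAt I x₀).symm) y :=
    (contDiffAt_comp_extChartAt_symm hy (hh _)).of_le ENat.LEInfty.out
  have hc' : ContDiffAt ℝ 1 (fderiv ℝ (h ∘ (extChartAt I x₀).symm)) y :=
    hc.fderiv_right (by norm_num)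
  have hY' := (contDiffAt_fieldInChart hy (hYat _)).differentiableAt (by simp)
  have hev := formInChart_mvfderiv_eventuallyEq hh hy
  have hev2 : (fun z => mvfderiv I h z (Y z)) ∘ (extChartAt I x₀).symm
      =ᶠ[𝓝 y] fun z => fderiv ℝ (h ∘ (extChartAt I x₀).symm) z (fieldInChart I Y x₀ z) := by
    filter_upwards [(isOpen_extChartAt_target x₀).mem_nhds hy, hev] with z hz hz'
    rw [← hz', formInChart_apply_fieldInChart _ Y hz, Function.comp_apply]
  rw [lieDerivForm_chartFrame isOpen_univ hω hy (mem_univ _) (hYat _), ← formInChart_apply,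
    ← fderiv_comp_extChartAt_symm hy hsm, hev2.fderiv_eq,
    fderiv_clm_apply (hc'.differentiableAt (by norm_num)) hY', coordLieDeriv,
    Filter.EventuallyEq.fderiv_eq hev, hev.self_of_nhds]
  have hsymm := (hc.isSymmSndFDerivAt (by simp)) v (fieldInChart I Y x₀ y)
  simp only [add_apply, ContinuousLinearMap.comp_apply, ContinuousLinearMap.flip_apply]
  rw [hsymm, add_comm]

end Chart

/-! ### Algebra of maximal isotropic subspaces -/

section Pairing

variable {E : Type*} [NormedAddCommGroup E] [NormedSpace ℝ E]
  {H : Type*} [TopologicalSpace H] {I : ModelWithCorners ℝ E H}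
  {M : Type*} [TopologicalSpace M] [ChartedSpace H M]

theorem pairing_comm {x : M} (a b : E1Fiber I x) : pairing I a b = pairing I b a := by
  unfold pairing
  ring

theorem pairing_add_smul_left {x : M} (a b c : E1Fiber I x) (r : ℝ) :
    pairing I (a + r • b) c = pairing I a c + r * pairing I b c := by
  simp [pairing]
  ring

theorem pairing_add_smul_right {x : M} (a b c : E1Fiber I x) (r : ℝ) :
    pairing I c (a + r • b) = pairing I c a + r * pairing I c b := by
  rw [pairing_comm, pairing_add_smul_left, pairing_comm a, pairing_comm b]

/-- A maximal isotropic subspace contains every isotropic vector orthogonal to it. -/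
theorem mem_of_pairing_eq_zero {x : M} {W : Submodule ℝ (E1Fiber I x)}
    (hW : Maximal (fun W : Submodule ℝ (E1Fiber I x) => IsIsotropic I W) W) {z : E1Fiber I x}
    (hz : pairing I z z = 0) (hzW : ∀ a ∈ W, pairing I z a = 0) : z ∈ W := by
  -- Adjoining the line through `z` keeps the space isotropic, so maximality forces `z` into `W`.
  have hiso : IsIsotropic I (W ⊔ ℝ ∙ z) := by
    intro a ha b hb
    obtain ⟨a', ha', _, hs, rfl⟩ := Submodule.mem_sup.1 ha
    obtain ⟨ra, rfl⟩ := Submodule.mem_span_singleton.1 hs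
    obtain ⟨b', hb', _, hs, rfl⟩ := Submodule.mem_sup.1 hb
    obtain ⟨rb, rfl⟩ := Submodule.mem_span_singleton.1 hs
    rw [pairing_add_smul_left, pairing_add_smul_right, pairing_add_smul_right, hz, hzW b' hb',
      pairing_comm a' z, hzW a' ha', hW.prop a' ha' b' hb']
    simp
  exact hW.le_of_ge hiso le_sup_left
    (Submodule.mem_sup_right (Submodule.mem_span_singleton_self z))

end Pairing

/-! ### Global sections and the annihilator description of `L ∩ (TM × ℝ)` -/

section Frame

variable {E : Type*} [NormedAddCommGroup E] [NormedSpace ℝ E]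
  {H : Type*} [TopologicalSpace H] {I : ModelWithCorners ℝ E H}
  {M : Type*} [TopologicalSpace M] [ChartedSpace H M] [IsManifold I ∞ M]

/-- Global smooth sections of a Dirac–Jacobi structure which form a frame near a given point. -/
theorem DiracJacobi.exists_global_sections [FiniteDimensional ℝ E] [T2Space M]
    (L : DiracJacobi I M) (x₀ : M) :
    ∃ (k : ℕ) (e : Fin k → Π x : M, E1Fiber I x),
      (∀ i, SmoothSectionOn I (e i) univ) ∧ (∀ i x, e i x ∈ L.fiber x) ∧
      ∀ᶠ x in 𝓝 x₀, LinearIndependent ℝ (fun i => e i x) ∧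
        Submodule.span ℝ (range fun i => e i x) = L.fiber x := by
  obtain ⟨U, hU, hxU, k, e, he, hspan⟩ := L.exists_frame x₀
  -- Integrability concerns global sections only, so the local frame is multiplied by a bump
  -- function equal to `1` near `x₀`.
  obtain ⟨χ, -, hχ⟩ := (SmoothBumpFunction.nhds_basis_tsupport (I := I) x₀).mem_iff.1
    (hU.mem_nhds hxU)
  refine ⟨k, fun i x => χ x • e i x, fun i => (he i).smul_of_tsupport hU χ.contMDiff hχ,
    fun i x => ?_, ?_⟩
  · by_cases hx : x ∈ U
    · exact (L.fiber x).smul_mem _ ((hspan x hx).2 ▸ Submodule.subset_span (mem_range_self i))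
    · have h0 : χ x = 0 := image_eq_zero_of_notMem_tsupport fun h => hx (hχ h)
      simp [h0]
  · filter_upwards [χ.eventuallyEq_one, hU.mem_nhds hxU] with x h1 hx
    simpa [h1] using hspan x hx

/-- Membership of a tangent element of `𝓔¹(M)` in a Dirac–Jacobi structure is tested on a
generating family. -/
theorem DiracJacobi.tangent_mem_iff (L : DiracJacobi I M) {x : M} {ι : Type*}
    {e : ι → E1Fiber I x} (he : Submodule.span ℝ (range e) = L.fiber x)
    (v : TangentSpace I x) (f : ℝ) :
    ((v, f), ((0 : Cotangent I x), (0 : ℝ))) ∈ L.fiber x ↔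
      ∀ i, (e i).2.1 v + (e i).2.2 * f = 0 := by
  have hpair : ∀ a : E1Fiber I x, pairing I ((v, f), ((0 : Cotangent I x), (0 : ℝ))) a
      = (1 / 2) * (a.2.1 v + a.2.2 * f) := fun a => by simp [pairing]
  constructor
  · intro h i
    have hi : e i ∈ L.fiber x := he ▸ Submodule.subset_span (mem_range_self i)
    have := (L.maximal x).prop _ h _ hi
    rw [hpair] at this
    linarith
  · intro h
    refine mem_of_pairing_eq_zero (L.maximal x) (by simp [pairing]) fun a ha => ?_
    rw [hpair]
    rw [← he] at ha
    induction ha using Submodule.span_induction with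
    | mem a ha => obtain ⟨i, rfl⟩ := ha; simp [h i]
    | zero => simp
    | add a b _ _ ha hb =>
      simp only [Prod.snd_add, Prod.fst_add, add_apply]
      linear_combination ha + hb
    | smul r a _ ha =>
      simp only [Prod.smul_snd, Prod.smul_fst, smul_apply, smul_eq_mul]
      linear_combination r * ha

end Frame

/-! ### The bracket with a Hamiltonian section -/

section Bracket

variable {E : Type*} [NormedAddCommGroup E] [NormedSpace ℝ E]
  {H : Type*} [TopologicalSpace H] {I : ModelWithCorners ℝ E H}
  {M : Type*} [TopologicalSpace M] [ChartedSpace H M]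

/-- The section `(X, φ) ⊕ (dh, h)`. -/
def hamiltonianSection (h : M → ℝ) (X : Π x : M, TangentSpace I x) (φ : M → ℝ) (x : M) :
    E1Fiber I x :=
  ((X x, φ x), (mvfderiv I h x, h x))

/-- Orthogonality is solved for `ξ(X)`, the term that enters the bracket with a factor `1/2`;
substituting it makes the brackets below collapse. -/
theorem form_apply_of_pairing_eq_zero {h φ : M → ℝ} {X : Π x : M, TangentSpace I x}
    {e : Π x : M, E1Fiber I x} (hpair : ∀ x, pairing I (hamiltonianSection h X φ x) (e x) = 0)
    (x : M) :
    (e x).2.1 (X x) = -(mvfderiv I h x (e x).1.1 + h x * (e x).1.2 + φ x * (e x).2.2) := by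
  have := hpair x
  simp only [pairing, hamiltonianSection] at this
  linarith

theorem extCourant_hamiltonianSection_cofn {h φ : M → ℝ} {X : Π x : M, TangentSpace I x}
    {e : Π x : M, E1Fiber I x} (hpair : ∀ x, pairing I (hamiltonianSection h X φ x) (e x) = 0)
    (x : M) :
    (extCourant I (hamiltonianSection h X φ) e x).2.2
      = mvfderiv I (fun x => (e x).2.2) x (X x) + φ x * (e x).2.2 := by
  simp only [extCourant, hamiltonianSection]
  rw [form_apply_of_pairing_eq_zero hpair x]
  ring

variable [IsManifold I ∞ M]

theorem contMDiff_mvfderiv_apply {f : M → ℝ} {X : Π x : M, TangentSpace I x}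
    (hf : ContMDiff I 𝓘(ℝ, ℝ) ∞ f) (hX : SmoothVectorFieldOn I X univ) :
    ContMDiff I 𝓘(ℝ, ℝ) ∞ fun x => mvfderiv I f x (X x) :=
  contMDiffOn_univ.1 fun x hx =>
    contMDiffWithinAt_form_apply (smoothOneFormOn_mvfderiv hf x hx) (hX x hx)

variable [FiniteDimensional ℝ E] [I.Boundaryless]

/-- The `1`-form component of the bracket of `(X, φ) ⊕ (dh, h)` with a section orthogonal to it. -/
theorem extCourant_hamiltonianSection_form {h φ : M → ℝ} {X : Π x : M, TangentSpace I x}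
    {e : Π x : M, E1Fiber I x} (hh : ContMDiff I 𝓘(ℝ, ℝ) ∞ h) (hφ : ContMDiff I 𝓘(ℝ, ℝ) ∞ φ)
    (he : SmoothSectionOn I e univ)
    (hpair : ∀ x, pairing I (hamiltonianSection h X φ x) (e x) = 0) (x : M) :
    (extCourant I (hamiltonianSection h X φ) e x).2.1
      = lieDerivForm I X (fun x => (e x).2.1) x + φ x • (e x).2.1
        + (e x).2.2 • mvfderiv I φ x := by
  let P : M → ℝ := fun x => mvfderiv I h x (e x).1.1
  let f : M → ℝ := fun x => (e x).1.2
  let g : M → ℝ := fun x => (e x).2.2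
  have d1 : MDifferentiableAt I 𝓘(ℝ, ℝ) P x :=
    (contMDiff_mvfderiv_apply hh he.vec x).mdifferentiableAt (by simp)
  have d2 : MDifferentiableAt I 𝓘(ℝ, ℝ) f x :=
    (contMDiffOn_univ.1 he.fn x).mdifferentiableAt (by simp)
  have d3 : MDifferentiableAt I 𝓘(ℝ, ℝ) g x :=
    (contMDiffOn_univ.1 he.cofn x).mdifferentiableAt (by simp)
  have d4 : MDifferentiableAt I 𝓘(ℝ, ℝ) h x := (hh x).mdifferentiableAt (by simp)
  have d5 : MDifferentiableAt I 𝓘(ℝ, ℝ) φ x := (hφ x).mdifferentiableAt (by simp)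
  -- Half the differential of `P + P` is `dP`, which cancels `-𝓛_Y dh = -dP`; the remaining products
  -- cancel the terms in `df`, `dg` and `dh`, leaving only `g dφ`.
  have hfun : (fun y => mvfderiv I h y (e y).1.1 - (e y).2.1 (X y))
      = fun y => (P y + P y) + (h y * f y + φ y * g y) := by
    funext y
    rw [form_apply_of_pairing_eq_zero hpair y]
    ring
  have hd : mvfderiv I (fun y => (P y + P y) + (h y * f y + φ y * g y)) x
      = (mvfderiv I P x + mvfderiv I P x) + ((h x • mvfderiv I f x + f x • mvfderiv I h x)
        + (φ x • mvfderiv I g x + g x • mvfderiv I φ x)) := by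
    rw [mvfderiv_fun_add (g := fun y => P y + P y) (g' := fun y => h y * f y + φ y * g y)
        (d1.add d1) ((d4.mul d2).add (d5.mul d3)), mvfderiv_fun_add d1 d1,
      mvfderiv_fun_add (g := fun y => h y * f y) (g' := fun y => φ y * g y)
        (d4.mul d2) (d5.mul d3), mvfderiv_fun_mul d4 d2, mvfderiv_fun_mul d5 d3]
  simp only [extCourant, hamiltonianSection]
  rw [hfun, hd, lieDerivForm_mvfderiv hh he.vec]
  module

end Bracket

/-! ### Sections and brackets as vector-valued maps in a chart -/

section ChartRead

variable {E : Type*} [NormedAddCommGroup E] [NormedSpace ℝ E]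
  {H : Type*} [TopologicalSpace H] {I : ModelWithCorners ℝ E H}
  {M : Type*} [TopologicalSpace M] [ChartedSpace H M]

variable (I) in
/-- The coordinates of an element of `𝓔¹(M)` over the point `y` of the chart at `x₀`. -/
def fiberCoord (x₀ : M) (y : E) :
    E1Fiber I ((extChartAt I x₀).symm y) →ₗ[ℝ] (E × ℝ) × ((E →L[ℝ] ℝ) × ℝ) where
  toFun a := (((chartFrame I x₀ y).inverse a.1.1, a.1.2), (a.2.1.comp (chartFrame I x₀ y), a.2.2))
  map_add' a b := Prod.ext (Prod.ext (map_add (chartFrame I x₀ y).inverse a.1.1 b.1.1) rfl)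
    (Prod.ext (ContinuousLinearMap.add_comp a.2.1 b.2.1 _) rfl)
  map_smul' r a := Prod.ext (Prod.ext (map_smul (chartFrame I x₀ y).inverse r a.1.1) rfl)
    (Prod.ext (ContinuousLinearMap.smul_comp r a.2.1 _) rfl)

/-- A section of `𝓔¹(M)` read in the chart at `x₀`. -/
def sectionInChart (I : ModelWithCorners ℝ E H) {M : Type*} [TopologicalSpace M] [ChartedSpace H M]
    (e : Π x : M, E1Fiber I x) (x₀ : M) (y : E) : (E × ℝ) × ((E →L[ℝ] ℝ) × ℝ) :=
  fiberCoord I x₀ y (e ((extChartAt I x₀).symm y))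

theorem sectionInChart_eq (e : Π x : M, E1Fiber I x) (x₀ : M) :
    sectionInChart I e x₀ = fun y =>
      ((fieldInChart I (fun x => (e x).1.1) x₀ y, ((fun x => (e x).1.2) ∘ (extChartAt I x₀).symm) y),
        (formInChart I (fun x => (e x).2.1) x₀ y,
          ((fun x => (e x).2.2) ∘ (extChartAt I x₀).symm) y)) :=
  rfl

variable [IsManifold I ∞ M]

theorem fiberCoord_injective {x₀ : M} {y : E} (hy : y ∈ (extChartAt I x₀).target) :
    Function.Injective (fiberCoord I x₀ y) := by
  obtain ⟨A, hA⟩ := chartFrame_isInvertible (I := I) hy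
  rintro ⟨⟨v, f⟩, ⟨ξ, g⟩⟩ ⟨⟨v', f'⟩, ⟨ξ', g'⟩⟩ h
  simp only [fiberCoord, LinearMap.coe_mk, AddHom.coe_mk, Prod.mk.injEq, ← hA,
    ContinuousLinearMap.inverse_equiv] at h
  obtain ⟨⟨hv, rfl⟩, hξ, rfl⟩ := h
  have h1 : v = v' := A.symm.injective hv
  have h2 : ξ = ξ' := by
    ext w
    obtain ⟨u, rfl⟩ := A.surjective w
    exact DFunLike.congr_fun hξ u
  rw [h1, h2]

variable [I.Boundaryless]

/-- The function component of the bracket with a hamiltonian section, in coordinates. -/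
theorem extCourant_cofn_inChart {h φ : M → ℝ} {X : Π x : M, TangentSpace I x}
    {e : Π x : M, E1Fiber I x} (he : SmoothSectionOn I e univ)
    (hpair : ∀ x, pairing I (hamiltonianSection h X φ x) (e x) = 0)
    {x₀ : M} {y : E} (hy : y ∈ (extChartAt I x₀).target) :
    (extCourant I (hamiltonianSection h X φ) e ((extChartAt I x₀).symm y)).2.2
      = fderiv ℝ ((fun x => (e x).2.2) ∘ (extChartAt I x₀).symm) y (fieldInChart I X x₀ y)
        + φ ((extChartAt I x₀).symm y) * (e ((extChartAt I x₀).symm y)).2.2 := by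
  rw [extCourant_hamiltonianSection_cofn hpair, ← formInChart_apply_fieldInChart _ X hy,
    (formInChart_mvfderiv_eventuallyEq (contMDiffOn_univ.1 he.cofn) hy).self_of_nhds]

variable [FiniteDimensional ℝ E]

theorem continuousAt_sectionInChart {e : Π x : M, E1Fiber I x} (he : SmoothSectionOn I e univ)
    {x₀ : M} {y : E} (hy : y ∈ (extChartAt I x₀).target) :
    ContinuousAt (sectionInChart I e x₀) y := by
  rw [sectionInChart_eq]
  exact ((contDiffAt_fieldInChart hy (contMDiffOn_univ.1 he.vec _)).continuousAt.prodMk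
    (contDiffAt_comp_extChartAt_symm hy (contMDiffOn_univ.1 he.fn _)).continuousAt).prodMk
    ((contDiffAt_formInChart isOpen_univ he.form hy (mem_univ _)).continuousAt.prodMk
    (contDiffAt_comp_extChartAt_symm hy (contMDiffOn_univ.1 he.cofn _)).continuousAt)

/-- The `1`-form component of the bracket with a hamiltonian section, in coordinates. -/
theorem formInChart_extCourant {h φ : M → ℝ} {X : Π x : M, TangentSpace I x}
    {e : Π x : M, E1Fiber I x} (hh : ContMDiff I 𝓘(ℝ, ℝ) ∞ h) (hφ : ContMDiff I 𝓘(ℝ, ℝ) ∞ φ)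
    (hX : SmoothVectorFieldOn I X univ) (he : SmoothSectionOn I e univ)
    (hpair : ∀ x, pairing I (hamiltonianSection h X φ x) (e x) = 0)
    {x₀ : M} {y : E} (hy : y ∈ (extChartAt I x₀).target) :
    formInChart I (fun x => (extCourant I (hamiltonianSection h X φ) e x).2.1) x₀ y
      = coordLieDeriv (fieldInChart I X x₀) (formInChart I (fun x => (e x).2.1) x₀) y
        + φ ((extChartAt I x₀).symm y) • formInChart I (fun x => (e x).2.1) x₀ y
        + (e ((extChartAt I x₀).symm y)).2.2 • fderiv ℝ (φ ∘ (extChartAt I x₀).symm) y := by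
  ext v
  rw [formInChart_apply, extCourant_hamiltonianSection_form hh hφ he hpair,
    (formInChart_mvfderiv_eventuallyEq hφ hy).self_of_nhds.symm]
  simp only [add_apply, smul_apply, formInChart_apply]
  rw [lieDerivForm_chartFrame isOpen_univ he.form hy (mem_univ _) (contMDiffOn_univ.1 hX _)]

/-- Continuity is what makes the bracket locally bounded in the chart, hence also its frame
coefficients. Each component is replaced near `y` by an expression built from smooth coordinate
data. -/
theorem continuousAt_sectionInChart_extCourant {h φ : M → ℝ} {X : Π x : M, TangentSpace I x}
    {e : Π x : M, E1Fiber I x} (hh : ContMDiff I 𝓘(ℝ, ℝ) ∞ h) (hφ : ContMDiff I 𝓘(ℝ, ℝ) ∞ φ)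
    (hX : SmoothVectorFieldOn I X univ) (he : SmoothSectionOn I e univ)
    (hpair : ∀ x, pairing I (hamiltonianSection h X φ x) (e x) = 0)
    {x₀ : M} {y : E} (hy : y ∈ (extChartAt I x₀).target) :
    ContinuousAt (sectionInChart I (extCourant I (hamiltonianSection h X φ) e) x₀) y := by
  have hnear := (isOpen_extChartAt_target (I := I) x₀).mem_nhds hy
  have hX' := contMDiffOn_univ.1 hX
  have hY' := contMDiffOn_univ.1 he.vec
  have cX := contDiffAt_fieldInChart hy (hX' _)
  have cY := contDiffAt_fieldInChart hy (hY' _)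
  have cξ := contDiffAt_formInChart isOpen_univ he.form hy (mem_univ _)
  have cφ := contDiffAt_comp_extChartAt_symm hy (hφ _)
  have cg := contDiffAt_comp_extChartAt_symm hy (contMDiffOn_univ.1 he.cofn _)
  rw [sectionInChart_eq]
  refine ContinuousAt.prodMk (ContinuousAt.prodMk ?_ ?_) (ContinuousAt.prodMk ?_ ?_)
  · refine ContinuousAt.congr (f := lieBracket ℝ (fieldInChart I X x₀)
      (fieldInChart I (fun x => (e x).1.1) x₀)) ?_ ?_
    · rw [lieBracket_eq]
      exact ((cY.continuousAt_fderiv (by simp)).clm_apply cX.continuousAt).sub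
        ((cX.continuousAt_fderiv (by simp)).clm_apply cY.continuousAt)
    · filter_upwards [hnear] with z hz
      exact (fieldInChart_mlieBracket hz (hX' _) (hY' _)).symm
  · exact (contDiffAt_comp_extChartAt_symm hy
      ((contMDiff_mvfderiv_apply (contMDiffOn_univ.1 he.fn) hX).sub
        (contMDiff_mvfderiv_apply hφ he.vec) _)).continuousAt
  · refine ContinuousAt.congr (f := fun z =>
      coordLieDeriv (fieldInChart I X x₀) (formInChart I (fun x => (e x).2.1) x₀) z
        + (φ ∘ (extChartAt I x₀).symm) z • formInChart I (fun x => (e x).2.1) x₀ z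
        + ((fun x => (e x).2.2) ∘ (extChartAt I x₀).symm) z •
          fderiv ℝ (φ ∘ (extChartAt I x₀).symm) z) ?_ ?_
    · refine ContinuousAt.add (ContinuousAt.add (ContinuousAt.add ?_ ?_) ?_) ?_
      · exact (cξ.continuousAt_fderiv (by simp)).clm_apply cX.continuousAt
      · exact cξ.continuousAt.clm_comp (cX.continuousAt_fderiv (by simp))
      · exact cφ.continuousAt.smul cξ.continuousAt
      · exact cg.continuousAt.smul (cφ.continuousAt_fderiv (by simp))
    · filter_upwards [hnear] with z hz
      exact (formInChart_extCourant hh hφ hX he hpair hz).symm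
  · have hsm : ContMDiff I 𝓘(ℝ, ℝ) ∞
        fun x => (extCourant I (hamiltonianSection h X φ) e x).2.2 :=
      ((contMDiff_mvfderiv_apply (contMDiffOn_univ.1 he.cofn) hX).add
        (hφ.mul (contMDiffOn_univ.1 he.cofn))).congr (extCourant_hamiltonianSection_cofn hpair)
    exact (contDiffAt_comp_extChartAt_symm hy (hsm _)).continuousAt

end ChartRead

/-! ### The derivative estimate and the two claims -/

section Main

variable {E : Type*} [NormedAddCommGroup E] [NormedSpace ℝ E]
  {H : Type*} [TopologicalSpace H] {I : ModelWithCorners ℝ E H}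
  {M : Type*} [TopologicalSpace M] [ChartedSpace H M] [IsManifold I ∞ M]
  {L : DiracJacobi I M} {h φ ψ : M → ℝ} {X : Π x : M, TangentSpace I x}

theorem DiracJacobi.IsHamiltonianPair.smoothSectionOn (hp : L.IsHamiltonianPair h X φ)
    (hh : ContMDiff I 𝓘(ℝ, ℝ) ∞ h) : SmoothSectionOn I (hamiltonianSection h X φ) univ :=
  ⟨hp.smooth_vec, hp.smooth_fn.contMDiffOn, smoothOneFormOn_mvfderiv hh, hh.contMDiffOn⟩

/-- The bracket with a hamiltonian section is controlled by a frame. -/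
theorem DiracJacobi.IsHamiltonianPair.bracket_bound [FiniteDimensional ℝ E] [I.Boundaryless]
    (hp : L.IsHamiltonianPair h X φ) (hh : ContMDiff I 𝓘(ℝ, ℝ) ∞ h) {x₀ : M} {k : ℕ}
    {e : Fin k → Π x : M, E1Fiber I x} (he : ∀ i, SmoothSectionOn I (e i) univ)
    (hmem : ∀ i x, e i x ∈ L.fiber x)
    (hframe : ∀ᶠ x in 𝓝 x₀, LinearIndependent ℝ (fun i => e i x) ∧
      Submodule.span ℝ (range fun i => e i x) = L.fiber x) :
    ∃ C, ∀ᶠ y in 𝓝 (extChartAt I x₀ x₀), ∀ j v f,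
      |coordLieDeriv (fieldInChart I X x₀) (formInChart I (fun x => (e j x).2.1) x₀) y v
        + fderiv ℝ ((fun x => (e j x).2.2) ∘ (extChartAt I x₀).symm) y (fieldInChart I X x₀ y) * f
        + ((fun x => (e j x).2.2) ∘ (extChartAt I x₀).symm) y *
          fderiv ℝ (φ ∘ (extChartAt I x₀).symm) y v|
        ≤ C * ‖fun i => formInChart I (fun x => (e i x).2.1) x₀ y v
          + ((fun x => (e i x).2.2) ∘ (extChartAt I x₀).symm) y * f‖ := by
  have hy := mem_extChartAt_target (I := I) x₀
  have hpair : ∀ j x, pairing I (hamiltonianSection h X φ x) (e j x) = 0 := fun j x =>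
    (L.maximal x).prop _ (hp.mem x) _ (hmem j x)
  let b : Fin k → Π x : M, E1Fiber I x := fun j => extCourant I (hamiltonianSection h X φ) (e j)
  have hb : ∀ j x, b j x ∈ L.fiber x := fun j =>
    L.bracket_mem _ _ (hp.smoothSectionOn hh) (he j) hp.mem (hmem j)
  have htend : Filter.Tendsto (extChartAt I x₀).symm (𝓝 (extChartAt I x₀ x₀)) (𝓝 x₀) := by
    have := (contMDiffAt_extChartAt_symm hy).continuousAt.tendsto
    rwa [extChartAt_to_inv x₀] at this
  have hli : LinearIndependent ℝ fun i => sectionInChart I (e i) x₀ (extChartAt I x₀ x₀) := by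
    have h1 : LinearIndependent ℝ
        fun i => e i ((extChartAt I x₀).symm (extChartAt I x₀ x₀)) := by
      rw [extChartAt_to_inv x₀]
      exact hframe.self_of_nhds.1
    exact h1.map' (fiberCoord I x₀ _) (LinearMap.ker_eq_bot.2 (fiberCoord_injective hy))
  obtain ⟨K, hK, hcoord⟩ := exists_coord_bound (fun i => continuousAt_sectionInChart (he i) hy) hli
  have hbound : ∀ᶠ y in 𝓝 (extChartAt I x₀ x₀), ∀ j, ‖sectionInChart I (b j) x₀ y‖ <
      ‖fun j => sectionInChart I (b j) x₀ (extChartAt I x₀ x₀)‖ + 1 := by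
    refine Filter.eventually_all.2 fun j => ?_
    have hc := (continuousAt_sectionInChart_extCourant hh hp.smooth_fn hp.smooth_vec (he j)
      (hpair j) hy).norm
    refine hc.eventually_lt continuousAt_const ?_
    have := norm_le_pi_norm (fun j => sectionInChart I (b j) x₀ (extChartAt I x₀ x₀)) j
    exact this.trans_lt (lt_add_one _)
  set B := ‖fun j => sectionInChart I (b j) x₀ (extChartAt I x₀ x₀)‖ + 1
  have hφb : ∀ᶠ y in 𝓝 (extChartAt I x₀ x₀), |φ ((extChartAt I x₀).symm y)| < |φ x₀| + 1 := by
    have hc := (hp.smooth_fn.continuous.tendsto x₀).comp htend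
    exact hc.abs.eventually_lt tendsto_const_nhds (lt_add_one _)
  -- `K * B` bounds each of the `k` frame coefficients of the bracket, and `|φ x₀| + 1` bounds `φ`
  -- near `x₀`.
  refine ⟨k * (K * B) + (|φ x₀| + 1), ?_⟩
  filter_upwards [hcoord, hbound, hφb, htend.eventually hframe,
    (isOpen_extChartAt_target (I := I) x₀).mem_nhds hy] with y hcoord hbound hφb hframe hy j v f
  obtain ⟨a, ha⟩ := (Submodule.mem_span_range_iff_exists_fun ℝ).1
    (hframe.2 ▸ hb j ((extChartAt I x₀).symm y))
  have hac : ∑ i, a i • sectionInChart I (e i) x₀ y = sectionInChart I (b j) x₀ y := by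
    unfold sectionInChart
    rw [← ha, map_sum]
    simp only [map_smul]
  have haK : ‖a‖ ≤ K * B := by
    refine (hcoord a).trans (mul_le_mul_of_nonneg_left ?_ hK.le)
    rw [hac]
    exact (hbound j).le
  set p : Fin k → ℝ := fun i => formInChart I (fun x => (e i x).2.1) x₀ y v
    + ((fun x => (e i x).2.2) ∘ (extChartAt I x₀).symm) y * f with hpdef
  have hform : formInChart I (fun x => (b j x).2.1) x₀ y
      = ∑ i, a i • formInChart I (fun x => (e i x).2.1) x₀ y := by
    have := congrArg (fun w => w.2.1) hac
    simp only [sectionInChart_eq, Prod.snd_sum, Prod.fst_sum, Prod.smul_snd, Prod.smul_fst] at this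
    exact this.symm
  have hcofn : (b j ((extChartAt I x₀).symm y)).2.2
      = ∑ i, a i * (e i ((extChartAt I x₀).symm y)).2.2 := by
    have := congrArg (fun w => w.2.2) hac
    simp only [sectionInChart_eq, Prod.snd_sum, Prod.smul_snd, smul_eq_mul] at this
    exact this.symm
  have e1 := DFunLike.congr_fun
    (formInChart_extCourant hh hp.smooth_fn hp.smooth_vec (he j) (hpair j) hy) v
  have e2 := extCourant_cofn_inChart (he j) (hpair j) hy
  have hsum : ∑ i, a i * p i = formInChart I (fun x => (b j x).2.1) x₀ y v
      + (b j ((extChartAt I x₀).symm y)).2.2 * f := by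
    rw [hform, hcofn, sum_apply, Finset.sum_mul, ← Finset.sum_add_distrib]
    refine Finset.sum_congr rfl fun i _ => ?_
    simp only [hpdef, smul_apply, smul_eq_mul, Function.comp_apply]
    ring
  -- The bracket carries the extra terms `φ ξ j` and `φ g j`, absent from the flow derivative;
  -- together they contribute `φ * p j`, which is subtracted.
  have hval : coordLieDeriv (fieldInChart I X x₀) (formInChart I (fun x => (e j x).2.1) x₀) y v
        + fderiv ℝ ((fun x => (e j x).2.2) ∘ (extChartAt I x₀).symm) y (fieldInChart I X x₀ y) * f
        + ((fun x => (e j x).2.2) ∘ (extChartAt I x₀).symm) y *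
          fderiv ℝ (φ ∘ (extChartAt I x₀).symm) y v
      = ∑ i, a i * p i - φ ((extChartAt I x₀).symm y) * p j := by
    simp only [add_apply, smul_apply, smul_eq_mul] at e1
    rw [hsum, e1, e2]
    simp only [hpdef, Function.comp_apply]
    ring
  rw [hval]
  have hB : 0 ≤ K * B := (norm_nonneg a).trans haK
  calc |∑ i, a i * p i - φ ((extChartAt I x₀).symm y) * p j|
      ≤ |∑ i, a i * p i| + |φ ((extChartAt I x₀).symm y) * p j| := abs_sub _ _
    _ ≤ ∑ i : Fin k, (K * B) * ‖p‖ + (|φ x₀| + 1) * ‖p‖ := by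
      refine add_le_add ((Finset.abs_sum_le_sum_abs _ _).trans
        (Finset.sum_le_sum fun i _ => ?_)) ?_
      · rw [abs_mul]
        exact mul_le_mul ((norm_le_pi_norm a i).trans haK) (norm_le_pi_norm p i)
          (abs_nonneg _) hB
      · rw [abs_mul]
        exact mul_le_mul hφb.le (norm_le_pi_norm p j) (abs_nonneg _) (by positivity)
    _ = (k * (K * B) + (|φ x₀| + 1)) * ‖p‖ := by
      rw [Finset.sum_const, Finset.card_univ, Fintype.card_fin, nsmul_eq_mul]
      ring

/-- The bracket of a basic function with an admissible function is basic. -/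
theorem DiracJacobi.IsBasic.bracket [FiniteDimensional ℝ E] [I.Boundaryless] [T2Space M]
    (hψ : L.IsBasic ψ) (hp : L.IsHamiltonianPair h X φ) (hh : ContMDiff I 𝓘(ℝ, ℝ) ∞ h) :
    L.IsBasic fun x => mvfderiv I ψ x (X x) + ψ x * φ x := by
  have hsm : ContMDiff I 𝓘(ℝ, ℝ) ∞ fun x => mvfderiv I ψ x (X x) + ψ x * φ x :=
    (contMDiff_mvfderiv_apply hψ.1 hp.smooth_vec).add (hψ.1.mul hp.smooth_fn)
  refine ⟨hsm, ?_⟩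
  -- Keeping `y` a variable, tied to `x₀` by an equation, allows all tangent spaces to be taken over
  -- `(extChartAt I x₀).symm y`.
  suffices key : ∀ (x₀ : M) (y : E), y ∈ (extChartAt I x₀).target → y = extChartAt I x₀ x₀ →
      ∀ (V : TangentSpace I ((extChartAt I x₀).symm y)) (f : ℝ),
      ((V, f), ((0 : Cotangent I _), (0 : ℝ))) ∈ L.fiber ((extChartAt I x₀).symm y) →
      mvfderiv I (fun x => mvfderiv I ψ x (X x) + ψ x * φ x) ((extChartAt I x₀).symm y) V
        + (mvfderiv I ψ ((extChartAt I x₀).symm y) (X ((extChartAt I x₀).symm y))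
          + ψ ((extChartAt I x₀).symm y) * φ ((extChartAt I x₀).symm y)) * f = 0 by
    intro x₀
    have h1 := key x₀ _ (mem_extChartAt_target x₀) rfl
    rwa [extChartAt_to_inv x₀] at h1
  intro x₀ y hy hyx V f hV
  have : CompleteSpace E := FiniteDimensional.complete ℝ E
  obtain ⟨v, rfl⟩ := (chartFrame_isInvertible (I := I) hy).surjective V
  obtain ⟨k, e, he, hmem, hframe⟩ := L.exists_global_sections x₀
  obtain ⟨C, hC⟩ := hp.bracket_bound hh he hmem hframe
  rw [← hyx] at hC
  have htend : Filter.Tendsto (extChartAt I x₀).symm (𝓝 y) (𝓝 x₀) := by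
    have := (contMDiffAt_extChartAt_symm hy).continuousAt.tendsto
    rwa [hyx, extChartAt_to_inv x₀, ← hyx] at this
  have hnear := (isOpen_extChartAt_target (I := I) x₀).mem_nhds hy
  have htwo : (2 : ℕ∞ω) ≤ ∞ := ENat.LEInfty.out
  have hψ' : ∀ z ∈ (extChartAt I x₀).target, ∀ w, mvfderiv I ψ ((extChartAt I x₀).symm z)
      (chartFrame I x₀ z w) = fderiv ℝ (ψ ∘ (extChartAt I x₀).symm) z w := fun z hz w => by
    rw [fderiv_comp_extChartAt_symm hz ((hψ.1 _).mdifferentiableAt (by simp)), formInChart_apply]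
  have hmain := twisted_derivative_annihilates (X := fieldInChart I X x₀)
    (φ := φ ∘ (extChartAt I x₀).symm) (ψ := ψ ∘ (extChartAt I x₀).symm)
    (ξ := fun i => formInChart I (fun x => (e i x).2.1) x₀)
    (g := fun i => (fun x => (e i x).2.2) ∘ (extChartAt I x₀).symm) (y₀ := y)
    ((contDiffAt_fieldInChart hy (contMDiffOn_univ.1 hp.smooth_vec _)).of_le htwo)
    ((contDiffAt_comp_extChartAt_symm hy (hp.smooth_fn _)).of_le htwo)
    ((contDiffAt_comp_extChartAt_symm hy (hψ.1 _)).of_le htwo)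
    (fun i => Filter.mem_of_superset hnear fun z hz =>
      (contDiffAt_formInChart isOpen_univ (he i).form hz (mem_univ _)).differentiableAt (by simp))
    (fun i => Filter.mem_of_superset hnear fun z hz =>
      (contDiffAt_comp_extChartAt_symm hz
        (contMDiffOn_univ.1 (he i).cofn _)).differentiableAt (by simp))
    hC ?_ (v₀ := v) (f₀ := f) ?_
  · rw [← formInChart_apply, ← fderiv_comp_extChartAt_symm hy
      ((hsm _).mdifferentiableAt (by simp))]
    have hev : (fun x => mvfderiv I ψ x (X x) + ψ x * φ x) ∘ (extChartAt I x₀).symm =ᶠ[𝓝 y]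
        fun z => fderiv ℝ (ψ ∘ (extChartAt I x₀).symm) z (fieldInChart I X x₀ z)
          + (ψ ∘ (extChartAt I x₀).symm) z * (φ ∘ (extChartAt I x₀).symm) z := by
      filter_upwards [hnear] with z hz
      rw [← hψ' z hz, chartFrame_fieldInChart X hz]
      rfl
    rw [hev.fderiv_eq]
    have h2 := hev.self_of_nhds
    simp only [Function.comp_apply] at h2
    rw [h2]
    exact hmain
  -- At every nearby point the annihilator of the frame is `L ∩ (TM × ℝ)`, where basicness of `ψ`
  -- applies.
  · filter_upwards [hnear, htend.eventually hframe] with z hz hfr w r hw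
    have := hψ.2 _ _ _ ((L.tangent_mem_iff hfr.2 (chartFrame I x₀ z w) r).2 hw)
    rwa [hψ' z hz] at this
  · exact (L.tangent_mem_iff (htend.eventually hframe).self_of_nhds.2 _ f).1 hV

/-- The lower parts `(dh, h)` cancel in the difference of the two sections, which therefore lies in
`L ∩ (TM × ℝ)`. -/
theorem DiracJacobi.IsBasic.bracket_eq (hψ : L.IsBasic ψ) (hp : L.IsHamiltonianPair h X φ)
    {X' : Π x : M, TangentSpace I x} {φ' : M → ℝ} (hp' : L.IsHamiltonianPair h X' φ') (x : M) :
    mvfderiv I ψ x (X x) + ψ x * φ x = mvfderiv I ψ x (X' x) + ψ x * φ' x := by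
  have hsub := (L.fiber x).sub_mem (hp.mem x) (hp'.mem x)
  have h0 := hψ.2 x (X x - X' x) (φ x - φ' x) (by simpa [Prod.mk_zero_zero] using hsub)
  rw [map_sub] at h0
  linarith

end Main

end DJ

end

/-- Independence of choices is encoded by letting one function `b` serve all Hamiltonian pairs;
admissibility supplies a pair, which pins `b` down. -/
theorem lemma3p1 {E : Type*} [NormedAddCommGroup E] [NormedSpace ℝ E] [FiniteDimensional ℝ E]
    {H : Type*} [TopologicalSpace H] {I : ModelWithCorners ℝ E H} [I.Boundaryless]
    {M : Type*} [TopologicalSpace M] [ChartedSpace H M] [IsManifold I ∞ M] [T2Space M]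
    (L : DJ.DiracJacobi I M) (ψ h : M → ℝ) (hψ : L.IsBasic ψ) (hh : L.IsAdmissible h) :
    ∃! b : M → ℝ,
      (∀ (X : Π x : M, TangentSpace I x) (φ : M → ℝ), L.IsHamiltonianPair h X φ →
        ∀ x, b x = mvfderiv I ψ x (X x) + ψ x * φ x) ∧
      L.IsBasic b := by
  obtain ⟨hsm, X, φ, hp⟩ := hh
  refine ⟨fun x => mvfderiv I ψ x (X x) + ψ x * φ x,
    ⟨fun X' φ' hp' x => hψ.bracket_eq hp hp' x, hψ.bracket hp hsm⟩, fun b hb => ?_⟩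
  funext x
  exact hb.1 X φ hp x
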